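/- Let $\mathcal X$ and $\mathcal Y$ be Polish spaces with their Borel $\sigma$-algebras, $\mathcal Y$ compact, and let $\rho$ be a Borel probability measure on $\mathcal X\times\mathcal Y$. Let $\Delta:\mathcal Y\times\mathcal Y\to\mathbb R$ be a loss of the form $\Delta(y,y')=\langle\psi(y),V\psi(y')\rangle_{\mathcal H}$, where $\mathcal H$ is a separable real Hilbert space, $\psi:\mathcal Y\to\mathcal H$ is continuous and $V:\mathcal H\to\mathcal H$ is bounded and linear. Put $\mathcal E(f)=\int\Delta(f(x),y)\,d\rho(x,y)$ for measurable $f:\mathcal X\to\mathcal Y$ and $\mathcal R(g)=\int\|g(x)-\psi(y)\|_{\mathcal H}^2\,d\rho(x,y)$ for measurable $g:\mathcal X\to\mathcal H$, and let $\mathcal E(f^*)=\inf_f\mathcal E(f)$, the infimum being over all measurable $f:\mathcal X\to\mathcal Y$. Let $k:\mathcal X\times\mathcal X\to\mathbb R$ be a bounded continuous (symmetric positive semidefinite) reproducing kernel and $\mathcal G$ the reproducing kernel Hilbert space of $\mathcal H$-valued functions on $\mathcal X$ with kernel $k(x,x')I_{\mathcal H}$. For $n\ge1$ and $(x_i,y_i)_{i=1}^n$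 drawn independently from $\rho$, let $\hat f_n:\mathcal X\to\mathcal Y$ be any measurable function with $$\hat f_n(x)\in\operatorname*{argmin}_{y\in\mathcal Y}\sum_{i=1}^n\alpha_i(x)\,\Delta(y,y_i)\quad\text{for all }x\in\mathcal X,\qquad \alpha(x)=(\mathbf K+n\lambda I)^{-1}\mathbf K_x\in\mathbb R^n,$$ where $\mathbf K_{ij}=k(x_i,x_j)$, $(\mathbf K_x)_i=k(x,x_i)$ and $\lambda=n^{-1/2}$. If $\mathcal R$ has a minimizer $g^*$ (over all measurable functions $\mathcal X\to\mathcal H$) that belongs to $\mathcal G$, then there is a constant $c$, not depending on $n$ and $\tau$, such that for every $n\ge1$ and every $\tau>0$ $$\mathcal E(\hat f_n)-\mathcal E(f^*)\le c\,\tau^2\,n^{-1/4}$$ holds with probability at least $1-8e^{-\tau}$. -/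

import Mathlib

open MeasureTheory

namespace StructuredPrediction

noncomputable section

/-- A (real, symmetric, positive semidefinite) reproducing kernel on `X`: for all finite families
of points `x i` and scalars `c i`, `∑ i, ∑ j, c i * c j * k (x i) (x j) ≥ 0`. -/
def IsReproducingKernel {X : Type*} (k : X → X → ℝ) : Prop :=
  (Matrix.of k).PosSemidef

/-- The separable operator-valued kernel `Γ(x, x') = k(x, x') I_H`. -/
def separableKernel {X : Type*} (H : Type*) [NormedAddCommGroup H] [InnerProductSpace ℝ H]
    (k : X → X → ℝ) : Matrix X X (H →L[ℝ] H) :=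
  Matrix.of fun x x' => k x x' • ContinuousLinearMap.id ℝ H

theorem separableKernel_posSemidef {X : Type*} {H : Type*} [NormedAddCommGroup H]
    [InnerProductSpace ℝ H] [CompleteSpace H] {k : X → X → ℝ} (hk : IsReproducingKernel k) :
    (separableKernel H k).PosSemidef := by
  have hsymm : ∀ x x', k x x' = k x' x := fun x x' => by
    simpa using hk.1.apply x' x
  have htfae := RKHS.posSemidef_tfae (K := separableKernel H k)
  apply (htfae.out 0 2).mpr
  refine ⟨?_, fun vv => ?_⟩
  · ext1 x x'
    change star (k x' x • (1 : H →L[ℝ] H)) = k x x' • (1 : H →L[ℝ] H)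
    rw [star_smul, star_one, star_trivial, hsymm x' x]
  · -- expand the inner products in an orthonormal basis of the span of the values of `vv`
    let S : Submodule ℝ H := Submodule.span ℝ (vv '' vv.support)
    have hS : ∀ x ∈ vv.support, vv x ∈ S := fun x hx =>
      Submodule.subset_span ⟨x, hx, rfl⟩
    have : FiniteDimensional ℝ S :=
      FiniteDimensional.span_of_finite ℝ (vv.support.finite_toSet.image vv)
    let b := stdOrthonormalBasis ℝ S
    have hb : ∀ x ∈ vv.support, ∀ x' ∈ vv.support,
        inner ℝ (vv x) (vv x') = ∑ i, inner ℝ (b i : H) (vv x) * inner ℝ (b i : H) (vv x') := by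
      intro x hx x' hx'
      have := b.sum_inner_mul_inner ⟨vv x, hS x hx⟩ ⟨vv x', hS x' hx'⟩
      simp only [Submodule.coe_inner] at this
      rw [← this]
      exact Finset.sum_congr rfl fun i _ => by rw [real_inner_comm]
    have key : ∀ i, 0 ≤ ∑ x ∈ vv.support, ∑ x' ∈ vv.support,
        inner ℝ (b i : H) (vv x) * k x x' * inner ℝ (b i : H) (vv x') := by
      intro i
      have h := hk.2 (Finsupp.onFinset vv.support (fun x => inner ℝ (b i : H) (vv x))
        (fun x hx => by
          rw [Finsupp.mem_support_iff]
          rintro h0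
          simp [h0] at hx))
      rw [Finsupp.onFinset_sum _ (by simp)] at h
      simp only [star_trivial] at h
      refine h.trans_eq (Finset.sum_congr rfl fun x _ => ?_)
      rw [Finsupp.onFinset_sum _ (by simp)]
      rfl
    have : (vv.sum fun x w => vv.sum fun x' w' => inner ℝ (separableKernel H k x' x w) w') =
        ∑ i, ∑ x ∈ vv.support, ∑ x' ∈ vv.support,
          inner ℝ (b i : H) (vv x) * k x x' * inner ℝ (b i : H) (vv x') := by
      rw [Finset.sum_comm]
      refine Finset.sum_congr rfl fun x hx => ?_
      rw [Finset.sum_comm]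
      refine Finset.sum_congr rfl fun x' hx' => ?_
      simp only [separableKernel, Matrix.of_apply, smul_apply,
        ContinuousLinearMap.id_apply, real_inner_smul_left]
      rw [hb x hx x' hx', hsymm x' x, Finset.mul_sum]
      exact Finset.sum_congr rfl fun i _ => by ring
    rw [this]
    simpa using Finset.sum_nonneg fun i _ => key i

/-- `g` belongs to `𝒢`, the reproducing kernel Hilbert space of `H`-valued functions on `X` with
kernel `k(x, x') I_H`. -/
def MemRKHS {X : Type*} {H : Type*} [NormedAddCommGroup H] [InnerProductSpace ℝ H]
    [CompleteSpace H] (k : X → X → ℝ) (hk : IsReproducingKernel k) (g : X → H) : Prop :=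
  haveI : Fact (separableKernel H k).PosSemidef := ⟨separableKernel_posSemidef hk⟩
  ∃ G : RKHS.OfKernel (separableKernel H k), ⇑G = g

/-- The expected risk `ℰ(f) = ∫ Δ(f(x), y) dρ(x, y)`. -/
def risk {X Y : Type*} [MeasurableSpace X] [MeasurableSpace Y] (ρ : Measure (X × Y))
    (Δ : Y → Y → ℝ) (f : X → Y) : ℝ :=
  ∫ p, Δ (f p.1) p.2 ∂ρ

/-- The optimal expected risk, the infimum of `ℰ` over all measurable functions; it is `ℰ(f*)` for
every minimizer `f*` (see `optimalRisk_eq_of_minimizer`). -/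
def optimalRisk {X Y : Type*} [MeasurableSpace X] [MeasurableSpace Y] (ρ : Measure (X × Y))
    (Δ : Y → Y → ℝ) : ℝ :=
  ⨅ f : {f : X → Y // Measurable f}, risk ρ Δ f

theorem optimalRisk_eq_of_minimizer {X Y : Type*} [MeasurableSpace X] [MeasurableSpace Y]
    {ρ : Measure (X × Y)} {Δ : Y → Y → ℝ} {fstar : X → Y} (hmeas : Measurable fstar)
    (hmin : ∀ f : X → Y, Measurable f → risk ρ Δ fstar ≤ risk ρ Δ f) :
    optimalRisk ρ Δ = risk ρ Δ fstar :=
  IsLeast.csInf_eq ⟨⟨⟨fstar, hmeas⟩, rfl⟩, by rintro _ ⟨f, rfl⟩; exact hmin f.1 f.2⟩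

/-- The surrogate risk `ℛ(g) = ∫ ‖g(x) - ψ(y)‖² dρ(x, y)`, with values in `[0, ∞]`. -/
def surrogateRisk {X Y : Type*} [MeasurableSpace X] [MeasurableSpace Y] {H : Type*}
    [NormedAddCommGroup H] (ρ : Measure (X × Y)) (ψ : Y → H) (g : X → H) : ENNReal :=
  ∫⁻ p, ‖g p.1 - ψ p.2‖ₑ ^ 2 ∂ρ

/-- `g` minimizes the surrogate risk over all measurable functions `X → H`. -/
def IsSurrogateMinimizer {X Y : Type*} [MeasurableSpace X] [MeasurableSpace Y] {H : Type*}
    [NormedAddCommGroup H] (ρ : Measure (X × Y)) (ψ : Y → H) (gstar : X → H) : Prop :=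
  StronglyMeasurable gstar ∧
    ∀ g : X → H, StronglyMeasurable g → surrogateRisk ρ ψ gstar ≤ surrogateRisk ρ ψ g

/-- The weights `α(x) = (K + n lam I)⁻¹ K_x`, with `K i j = k(x_i, x_j)` and
`(K_x) i = k(x, x_i)`. -/
def weights {X : Type*} {n : ℕ} (k : X → X → ℝ) (lam : ℝ) (xs : Fin n → X) (x : X) :
    Fin n → ℝ :=
  ((Matrix.of fun i j => k (xs i) (xs j)) + ((n : ℝ) * lam) • (1 : Matrix (Fin n) (Fin n) ℝ))⁻¹.mulVec
    fun i => k x (xs i)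

/-- `f` is an output of the algorithm on the sample `z`: a measurable function such that, for every
`x`, `f x` minimizes `y ↦ ∑ i, α_i(x) Δ(y, y_i)` over `Y`. -/
def IsAlgorithmOutput {X Y : Type*} [MeasurableSpace X] [MeasurableSpace Y] {n : ℕ}
    (Δ : Y → Y → ℝ) (k : X → X → ℝ) (lam : ℝ) (z : Fin n → X × Y) (f : X → Y) : Prop :=
  Measurable f ∧ ∀ x : X, ∀ y : Y,
    ∑ i, weights k lam (fun j => (z j).1) x i * Δ (f x) (z i).2 ≤
      ∑ i, weights k lam (fun j => (z j).1) x i * Δ y (z i).2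

end

end StructuredPrediction

open StructuredPrediction

namespace StructuredPrediction

open scoped TensorProduct

/-! Since `Δ` is bilinear in `ψ`, the weighted objective at `x` is `⟨ψ y, V (ĝ x)⟩` with `ĝ x = ∑ i,
α_i(x) • ψ (y_i)`, the kernel ridge regression estimator of `g*`. As `g*` is the conditional mean of
`ψ(y)` given `x`, the excess risk of the decoded function is at most a constant times the `L²` norm
of `δ = ĝ - g*` (`risk_sub_le_sqrt_integral_norm_sq`).

The normal equations for `ĝ` give an energy identity for `δ` (`exists_ridge_error`): `lam ‖δ‖²` plus
the empirical second moment of `δ` equals a noise term minus `lam ⟨δ, g*⟩`. The noise is an average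
of centred bounded vectors, of norm `O(τ n^(-1/2)) = O(τ lam)`; so `‖δ‖ = O(τ)` and the empirical
second moment is `O(τ² lam)`.

The passage to the population second moment must be uniform over the unit ball, and must not depend
on the dimension of `H`. For `f` in the vector-valued space, `‖f x‖²` is a linear functional of norm
at most `‖f‖²` applied to `φ x ⊗ φ x`, where `φ` is a feature map of the scalar kernel
(`integral_norm_sq_sub_le`). The deviation is thus again that of an average of bounded Hilbert-space
vectors, `O(τ lam)`. A square root yields `√lam = n^(-1/4)`. Both averages are controlled by
`measureReal_norm_sum_sq_gt_le`. -/

/-! ### Concentration of sums of bounded centred vectors in a Hilbert space. -/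

/-- Expanding the square leaves the scalar `⟨v, ξ⟩`, centred and bounded by `‖v‖ M`, to which
Hoeffding's lemma applies. Lowering `N + 1` to `N` in the denominator absorbs its contribution, so
the estimate can be iterated. -/
theorem lintegral_exp_norm_add_sq_le {Z : Type*} [MeasurableSpace Z] {μ : Measure Z}
    [IsProbabilityMeasure μ] {E : Type*} [NormedAddCommGroup E] [InnerProductSpace ℝ E]
    [CompleteSpace E] {ξ : Z → E} (hξ : StronglyMeasurable ξ) {M : ℝ} (hM : 0 < M)
    (hb : ∀ z, ‖ξ z‖ ≤ M) (h0 : ∫ z, ξ z ∂μ = 0) {N : ℝ} (hN : 0 < N) (v : E) :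
    ∫⁻ z, ENNReal.ofReal (Real.exp (‖v + ξ z‖ ^ 2 / (2 * M ^ 2 * (N + 1)))) ∂μ ≤
      ENNReal.ofReal (Real.exp (‖v‖ ^ 2 / (2 * M ^ 2 * N) + 1 / (2 * (N + 1)))) := by
  have hint : Integrable ξ μ :=
    Integrable.of_bound hξ.aestronglyMeasurable M (ae_of_all _ hb)
  have hmeas : StronglyMeasurable fun z => inner ℝ v (ξ z) :=
    stronglyMeasurable_const.inner hξ
  have habs : ∀ z, |inner ℝ v (ξ z)| ≤ ‖v‖ * M := fun z =>
    (abs_real_inner_le_norm v (ξ z)).trans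
      (mul_le_mul_of_nonneg_left (hb z) (norm_nonneg v))
  have hsub := ProbabilityTheory.hasSubgaussianMGF_of_mem_Icc_of_integral_eq_zero
    (μ := μ) (X := fun z => inner ℝ v (ξ z)) (a := -(‖v‖ * M)) (b := ‖v‖ * M)
    hmeas.measurable.aemeasurable
    (ae_of_all _ fun z => Set.mem_Icc.2 (abs_le.1 (habs z)))
    (by rw [integral_inner hint, h0, inner_zero_right])
  set t : ℝ := 1 / (M ^ 2 * (N + 1)) with ht
  have hmgf := hsub.mgf_le t
  have hexp := hsub.integrable_exp_mul t
  rw [ProbabilityTheory.mgf] at hmgf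
  have hle : ∀ z, Real.exp (‖v + ξ z‖ ^ 2 / (2 * M ^ 2 * (N + 1))) ≤
      Real.exp (‖v‖ ^ 2 / (2 * M ^ 2 * (N + 1)) + 1 / (2 * (N + 1))) *
        Real.exp (t * inner ℝ v (ξ z)) := by
    intro z
    rw [← Real.exp_add, Real.exp_le_exp, norm_add_sq_real]
    have : ‖ξ z‖ ^ 2 ≤ M ^ 2 := by gcongr; exact hb z
    calc (‖v‖ ^ 2 + 2 * inner ℝ v (ξ z) + ‖ξ z‖ ^ 2) / (2 * M ^ 2 * (N + 1))
        ≤ (‖v‖ ^ 2 + 2 * inner ℝ v (ξ z) + M ^ 2) / (2 * M ^ 2 * (N + 1)) := by gcongr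
      _ = _ := by rw [ht]; field_simp; ring
  calc _ ≤ ∫⁻ z, ENNReal.ofReal (Real.exp (‖v‖ ^ 2 / (2 * M ^ 2 * (N + 1)) + 1 / (2 * (N + 1))) *
        Real.exp (t * inner ℝ v (ξ z))) ∂μ :=
        lintegral_mono fun z => ENNReal.ofReal_le_ofReal (hle z)
    _ = ENNReal.ofReal (∫ z, Real.exp (‖v‖ ^ 2 / (2 * M ^ 2 * (N + 1)) + 1 / (2 * (N + 1))) *
        Real.exp (t * inner ℝ v (ξ z)) ∂μ) :=
        (ofReal_integral_eq_lintegral_ofReal (hexp.const_mul _)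
          (ae_of_all _ fun z => by positivity)).symm
    _ ≤ _ := by
        rw [integral_const_mul]
        apply ENNReal.ofReal_le_ofReal
        refine (mul_le_mul_of_nonneg_left hmgf (Real.exp_pos _).le).trans ?_
        rw [← Real.exp_add, Real.exp_le_exp]
        have hc : (((‖‖v‖ * M - -(‖v‖ * M)‖₊ / 2) ^ 2 : NNReal) : ℝ) = ‖v‖ ^ 2 * M ^ 2 := by
          push_cast
          rw [Real.norm_eq_abs, div_pow, sq_abs]
          ring
        rw [hc, ht]
        -- This is `N (N + 2) ≤ (N + 1) ^ 2`; the second summand on the left comes from Hoeffding's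
        -- lemma.
        have key : 1 / (N + 1) + 1 / (N + 1) ^ 2 ≤ 1 / N := by
          rw [div_add_div _ _ (by positivity) (by positivity),
            div_le_div_iff₀ (by positivity) hN]
          nlinarith [sq_nonneg N, pow_pos hN 3]
        have := mul_le_mul_of_nonneg_left key (by positivity : 0 ≤ ‖v‖ ^ 2 / (2 * M ^ 2))
        calc _ = ‖v‖ ^ 2 / (2 * M ^ 2) * (1 / (N + 1) + 1 / (N + 1) ^ 2) + 1 / (2 * (N + 1)) := by
              field_simp; ring
          _ ≤ ‖v‖ ^ 2 / (2 * M ^ 2) * (1 / N) + 1 / (2 * (N + 1)) := by gcongr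
          _ = _ := by field_simp

theorem stronglyMeasurable_sum_comp_eval {Z : Type*} [MeasurableSpace Z] {E : Type*}
    [NormedAddCommGroup E] {ξ : Z → E} (hξ : StronglyMeasurable ξ) (m : ℕ) :
    StronglyMeasurable fun z : Fin m → Z => ∑ i, ξ (z i) :=
  Finset.stronglyMeasurable_fun_sum _ fun i _ => hξ.comp_measurable (measurable_pi_apply i)

theorem lintegral_exp_norm_add_sum_sq_le {Z : Type*} [MeasurableSpace Z] {μ : Measure Z}
    [IsProbabilityMeasure μ] {E : Type*} [NormedAddCommGroup E] [InnerProductSpace ℝ E]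
    [CompleteSpace E] {ξ : Z → E} (hξ : StronglyMeasurable ξ) {M : ℝ} (hM : 0 < M)
    (hb : ∀ z, ‖ξ z‖ ≤ M) (h0 : ∫ z, ξ z ∂μ = 0) (m : ℕ) {N : ℝ} (hN : 0 < N) (v : E) :
    ∫⁻ z, ENNReal.ofReal (Real.exp (‖v + ∑ i, ξ (z i)‖ ^ 2 / (2 * M ^ 2 * (N + m))))
        ∂(Measure.pi fun _ : Fin m => μ) ≤
      ENNReal.ofReal (Real.exp (‖v‖ ^ 2 / (2 * M ^ 2 * N) + m / (2 * N))) := by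
  induction m generalizing N v with
  | zero => simp
  | succ m ih =>
    have hmp := (measurePreserving_piFinSuccAbove (fun _ : Fin (m + 1) => μ) 0).symm
    rw [← hmp.lintegral_comp_emb (MeasurableEquiv.measurableEmbedding _)]
    have hexp : ∀ p : Z × (Fin m → Z),
        v + ∑ i, ξ ((MeasurableEquiv.piFinSuccAbove (fun _ : Fin (m + 1) => Z) 0).symm p i) =
          (v + ξ p.1) + ∑ i, ξ (p.2 i) := by
      intro p
      rw [Fin.sum_univ_succ, ← add_assoc]
      rfl
    simp only [hexp]
    have hm : Measurable fun p : Z × (Fin m → Z) => ENNReal.ofReal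
        (Real.exp (‖v + ξ p.1 + ∑ i, ξ (p.2 i)‖ ^ 2 / (2 * M ^ 2 * (N + (m + 1 : ℕ))))) := by
      have h1 : StronglyMeasurable fun p : Z × (Fin m → Z) => v + ξ p.1 + ∑ i, ξ (p.2 i) :=
        (stronglyMeasurable_const.add (hξ.comp_measurable measurable_fst)).add
          ((stronglyMeasurable_sum_comp_eval hξ m).comp_measurable measurable_snd)
      exact (((h1.norm.measurable.pow_const 2).div_const _).exp).ennreal_ofReal
    refine (lintegral_prod _ hm.aemeasurable).trans_le ?_
    have hN1 : 0 < N + 1 := by positivity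
    calc _ ≤ ∫⁻ x, ENNReal.ofReal (Real.exp (‖v + ξ x‖ ^ 2 / (2 * M ^ 2 * (N + 1)) +
          m / (2 * (N + 1)))) ∂μ := by
          refine lintegral_mono fun x => ?_
          have := ih hN1 (v + ξ x)
          rw [add_assoc N 1, add_comm (1 : ℝ)] at this
          push_cast
          exact this
      _ = (∫⁻ x, ENNReal.ofReal (Real.exp (‖v + ξ x‖ ^ 2 / (2 * M ^ 2 * (N + 1)))) ∂μ) *
          ENNReal.ofReal (Real.exp (m / (2 * (N + 1)))) := by
          rw [← lintegral_mul_const']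
          · refine lintegral_congr fun x => ?_
            rw [Real.exp_add, ENNReal.ofReal_mul (Real.exp_pos _).le]
          · exact ENNReal.ofReal_ne_top
      _ ≤ ENNReal.ofReal (Real.exp (‖v‖ ^ 2 / (2 * M ^ 2 * N) + 1 / (2 * (N + 1)))) *
          ENNReal.ofReal (Real.exp (m / (2 * (N + 1)))) := by
          gcongr
          exact lintegral_exp_norm_add_sq_le hξ hM hb h0 hN v
      _ ≤ _ := by
          rw [← ENNReal.ofReal_mul (Real.exp_pos _).le, ← Real.exp_add]
          apply ENNReal.ofReal_le_ofReal
          rw [Real.exp_le_exp, add_assoc]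
          gcongr
          rw [← add_div]
          push_cast
          rw [add_comm (1 : ℝ)]
          gcongr
          linarith

/-- A dimension-free sub-Gaussian tail bound for sums of independent bounded centred random
vectors in a Hilbert space. -/
theorem measureReal_norm_sum_sq_gt_le {Z : Type*} [MeasurableSpace Z] {μ : Measure Z}
    [IsProbabilityMeasure μ] {E : Type*} [NormedAddCommGroup E] [InnerProductSpace ℝ E]
    [CompleteSpace E] {ξ : Z → E} (hξ : StronglyMeasurable ξ) {M : ℝ} (hM : 0 < M)
    (hb : ∀ z, ‖ξ z‖ ≤ M) (h0 : ∫ z, ξ z ∂μ = 0) {n : ℕ} (hn : 1 ≤ n) (τ : ℝ) :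
    (Measure.pi fun _ : Fin n => μ).real
        {z | 4 * M ^ 2 * n * (τ + 1 / 2) < ‖∑ i, ξ (z i)‖ ^ 2} ≤ Real.exp (-τ) := by
  have hn0 : (0 : ℝ) < n := by exact_mod_cast hn
  -- Starting from `N = n` and `v = 0`, the `n` steps end with denominator `4 M² n` and the bound
  -- `exp (1 / 2)`; Markov's inequality does the rest.
  have h := lintegral_exp_norm_add_sum_sq_le hξ hM hb h0 n hn0 0
  have hm : Measurable fun z : Fin n → Z => ENNReal.ofReal
      (Real.exp (‖(0 : E) + ∑ i, ξ (z i)‖ ^ 2 / (2 * M ^ 2 * (n + n)))) :=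
    ((((stronglyMeasurable_const.add (stronglyMeasurable_sum_comp_eval hξ n)).norm.measurable.pow_const
      2).div_const _).exp).ennreal_ofReal
  have hmk := meas_ge_le_lintegral_div (μ := Measure.pi fun _ : Fin n => μ) hm.aemeasurable
    (ε := ENNReal.ofReal (Real.exp (τ + 1 / 2)))
    (by simpa using Real.exp_pos _) ENNReal.ofReal_ne_top
  refine ENNReal.toReal_le_of_le_ofReal (Real.exp_pos _).le ?_
  refine (measure_mono ?_).trans (hmk.trans ((ENNReal.div_le_div_right h _).trans ?_))
  · intro z hz
    simp only [Set.mem_ofPred_eq] at hz ⊢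
    apply ENNReal.ofReal_le_ofReal
    rw [Real.exp_le_exp, le_div_iff₀ (by positivity), zero_add]
    nlinarith [hz]
  · rw [← ENNReal.ofReal_div_of_pos (Real.exp_pos _), ← Real.exp_sub]
    apply ENNReal.ofReal_le_ofReal
    rw [Real.exp_le_exp, norm_zero]
    apply le_of_eq
    field_simp
    ring

/-! ### The vector-valued space with kernel `k(x, x') I_H`. -/

section RKHS

variable {X H G F : Type*} [NormedAddCommGroup H] [InnerProductSpace ℝ H] [CompleteSpace H]
  [NormedAddCommGroup G] [InnerProductSpace ℝ G] [CompleteSpace G] [RKHS ℝ G X H]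
  [NormedAddCommGroup F] [InnerProductSpace ℝ F]
  {k : X → X → ℝ}

theorem kerFun_apply_of_kernel_eq (hG : RKHS.kernel G = separableKernel H k) (x x' : X) (v : H) :
    RKHS.kerFun G x' v x = k x x' • v := by
  rw [RKHS.kerFun_apply, hG]
  rfl

theorem inner_kerFun_kerFun (hG : RKHS.kernel G = separableKernel H k) (x x' : X) (v w : H) :
    inner ℝ (RKHS.kerFun G x v) (RKHS.kerFun G x' w) = k x x' * inner ℝ v w := by
  rw [RKHS.kerFun_inner, kerFun_apply_of_kernel_eq hG, real_inner_smul_right]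

theorem norm_kerFun_apply_le (hG : RKHS.kernel G = separableKernel H k) {κ : ℝ} (hκ : 0 ≤ κ)
    (hk : ∀ x, k x x ≤ κ ^ 2) (x : X) (v : H) : ‖RKHS.kerFun G x v‖ ≤ κ * ‖v‖ := by
  refine (sq_le_sq₀ (norm_nonneg _) (by positivity)).1 ?_
  rw [← real_inner_self_eq_norm_sq, inner_kerFun_kerFun hG, real_inner_self_eq_norm_sq, mul_pow]
  gcongr
  exact hk x

theorem norm_apply_le_of_kernel_eq (hG : RKHS.kernel G = separableKernel H k) {κ : ℝ}
    (hκ : 0 ≤ κ) (hk : ∀ x, k x x ≤ κ ^ 2) (f : G) (x : X) : ‖f x‖ ≤ κ * ‖f‖ := by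
  rcases eq_or_ne (f x) 0 with h | h
  · rw [h, norm_zero]; positivity
  have h1 : ‖f x‖ ^ 2 ≤ ‖f‖ * (κ * ‖f x‖) := by
    rw [← real_inner_self_eq_norm_sq, ← RKHS.kerFun_inner, real_inner_comm]
    exact (real_inner_le_norm _ _).trans
      (mul_le_mul_of_nonneg_left (norm_kerFun_apply_le hG hκ hk x _) (norm_nonneg _))
  have h2 : 0 < ‖f x‖ := norm_pos_iff.2 h
  nlinarith

theorem continuous_kerFun_apply [TopologicalSpace X] (hG : RKHS.kernel G = separableKernel H k)
    (hk : Continuous fun p : X × X => k p.1 p.2) :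
    Continuous fun p : X × H => RKHS.kerFun G p.1 p.2 := by
  rw [continuous_iff_continuousAt]
  rintro ⟨x₀, v₀⟩
  rw [ContinuousAt, tendsto_iff_norm_sub_tendsto_zero]
  have h : ∀ p : X × H, ‖RKHS.kerFun G p.1 p.2 - RKHS.kerFun G x₀ v₀‖ =
      √(k p.1 p.1 * inner ℝ p.2 p.2 - 2 * (k p.1 x₀ * inner ℝ p.2 v₀) +
        k x₀ x₀ * inner ℝ v₀ v₀) := by
    intro p
    rw [← inner_kerFun_kerFun hG, ← inner_kerFun_kerFun hG, ← inner_kerFun_kerFun hG,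
      real_inner_self_eq_norm_sq, real_inner_self_eq_norm_sq, ← norm_sub_sq_real,
      Real.sqrt_sq (norm_nonneg _)]
  simp only [h]
  have h1 : Continuous fun p : X × H => k p.1 p.1 :=
    hk.comp (continuous_fst.prodMk continuous_fst)
  have h2 : Continuous fun p : X × H => k p.1 x₀ :=
    hk.comp (continuous_fst.prodMk continuous_const)
  have hc : Continuous fun p : X × H =>
      √(k p.1 p.1 * inner ℝ p.2 p.2 - 2 * (k p.1 x₀ * inner ℝ p.2 v₀) +
        k x₀ x₀ * inner ℝ v₀ v₀) := by fun_prop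
  have := hc.tendsto (x₀, v₀)
  simp only at this
  convert! this using 2
  rw [eq_comm, Real.sqrt_eq_zero']
  linarith

/-- Each `f` is Lipschitz for the kernel pseudometric: `f x - f x₀` is paired with itself, and the
reproducing property moves the pairing onto a difference of kernel functions. -/
theorem continuous_coe_of_kernel_eq [TopologicalSpace X]
    (hG : RKHS.kernel G = separableKernel H k)
    (hk : Continuous fun p : X × X => k p.1 p.2) (f : G) : Continuous f := by
  rw [continuous_iff_continuousAt]
  intro x₀
  rw [ContinuousAt, tendsto_iff_norm_sub_tendsto_zero]
  have hb : ∀ x, ‖f x - f x₀‖ ≤ ‖f‖ * √(k x x - 2 * k x x₀ + k x₀ x₀) := by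
    intro x
    have h1 : ∀ w : H, ‖RKHS.kerFun G x w - RKHS.kerFun G x₀ w‖ ^ 2 =
        (k x x - 2 * k x x₀ + k x₀ x₀) * ‖w‖ ^ 2 := by
      intro w
      rw [norm_sub_sq_real, ← real_inner_self_eq_norm_sq, ← real_inner_self_eq_norm_sq,
        inner_kerFun_kerFun hG, inner_kerFun_kerFun hG, inner_kerFun_kerFun hG,
        real_inner_self_eq_norm_sq]
      ring
    set w := f x - f x₀ with hw
    rcases eq_or_ne w 0 with h | h
    · rw [h, norm_zero]; positivity
    have hw0 : 0 < ‖w‖ := norm_pos_iff.2 h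
    have hs : ‖RKHS.kerFun G x w - RKHS.kerFun G x₀ w‖ = √(k x x - 2 * k x x₀ + k x₀ x₀) * ‖w‖ := by
      rw [← Real.sqrt_sq (norm_nonneg (RKHS.kerFun G x w - RKHS.kerFun G x₀ w)), h1,
        Real.sqrt_mul' _ (by positivity), Real.sqrt_sq hw0.le]
    have h2 : ‖w‖ ^ 2 ≤ ‖f‖ * (√(k x x - 2 * k x x₀ + k x₀ x₀) * ‖w‖) := by
      rw [← hs]
      refine le_trans (le_of_eq ?_)
        (real_inner_le_norm f (RKHS.kerFun G x w - RKHS.kerFun G x₀ w))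
      rw [inner_sub_right, RKHS.inner_kerFun, RKHS.inner_kerFun, ← inner_sub_left, ← hw,
        real_inner_self_eq_norm_sq]
    nlinarith
  have h1 : Continuous fun x : X => k x x := hk.comp (continuous_id.prodMk continuous_id)
  have h2 : Continuous fun x : X => k x x₀ := hk.comp (continuous_id.prodMk continuous_const)
  have hcont : Continuous fun x : X => ‖f‖ * √(k x x - 2 * k x x₀ + k x₀ x₀) := by fun_prop
  have ht := hcont.tendsto x₀
  have hz : ‖f‖ * √(k x₀ x₀ - 2 * k x₀ x₀ + k x₀ x₀) = 0 := by
    rw [show k x₀ x₀ - 2 * k x₀ x₀ + k x₀ x₀ = 0 by ring]; simp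
  rw [hz] at ht
  exact squeeze_zero (fun _ => norm_nonneg _) hb ht

/-- A feature map of a continuous kernel is continuous. -/
theorem continuous_of_inner_eq [TopologicalSpace X] {φ : X → F}
    (hφ : ∀ x x', inner ℝ (φ x) (φ x') = k x x')
    (hk : Continuous fun p : X × X => k p.1 p.2) : Continuous φ := by
  rw [continuous_iff_continuousAt]
  intro x₀
  rw [ContinuousAt, tendsto_iff_norm_sub_tendsto_zero]
  have h : ∀ x, ‖φ x - φ x₀‖ = √(k x x - 2 * k x x₀ + k x₀ x₀) := by
    intro x
    rw [← hφ, ← hφ, ← hφ, real_inner_self_eq_norm_sq, real_inner_self_eq_norm_sq,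
      ← norm_sub_sq_real, Real.sqrt_sq (norm_nonneg _)]
  simp only [h]
  have h1 : Continuous fun x : X => k x x := hk.comp (continuous_id.prodMk continuous_id)
  have h2 : Continuous fun x : X => k x x₀ := hk.comp (continuous_id.prodMk continuous_const)
  have hc : Continuous fun x : X => √(k x x - 2 * k x x₀ + k x₀ x₀) := by fun_prop
  have ht := hc.tendsto x₀
  rwa [show k x₀ x₀ - 2 * k x₀ x₀ + k x₀ x₀ = 0 by ring, Real.sqrt_zero] at ht

/-- The square of the pointwise norm of a finite combination of kernel functions is a bounded
linear functional of the tensor square of any feature map of the scalar kernel. -/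
theorem exists_tensor_inner_eq_norm_sq_sum_kerFun (hG : RKHS.kernel G = separableKernel H k)
    {φ : X → F} (hφ : ∀ x x', inner ℝ (φ x) (φ x') = k x x') {m : ℕ} (z : Fin m → X)
    (h : Fin m → H) :
    ∃ W : F ⊗[ℝ] F, ‖W‖ ≤ ‖∑ j, RKHS.kerFun G (z j) (h j)‖ ^ 2 ∧
      ∀ x, inner ℝ W (φ x ⊗ₜ[ℝ] φ x) = ‖(∑ j, RKHS.kerFun G (z j) (h j)) x‖ ^ 2 := by
  have hf : ∀ x, (∑ j, RKHS.kerFun G (z j) (h j)) x = ∑ j, k x (z j) • h j := by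
    intro x
    rw [← RKHS.adjoint_kerFun, map_sum]
    refine Finset.sum_congr rfl fun j _ => ?_
    rw [RKHS.adjoint_kerFun, kerFun_apply_of_kernel_eq hG]
  set f : G := ∑ j, RKHS.kerFun G (z j) (h j)
  let S : Submodule ℝ H := Submodule.span ℝ (Set.range h)
  have hS : ∀ j, h j ∈ S := fun j => Submodule.subset_span ⟨j, rfl⟩
  have : FiniteDimensional ℝ S := FiniteDimensional.span_of_finite ℝ (Set.finite_range h)
  let b := stdOrthonormalBasis ℝ S
  have hfS : ∀ x, f x ∈ S := fun x => by
    rw [hf]; exact S.sum_mem fun j _ => S.smul_mem _ (hS j)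
  have hb : ∀ v ∈ S, ∀ w ∈ S, inner ℝ v w = ∑ i, inner ℝ (b i : H) v * inner ℝ (b i : H) w := by
    intro v hv w hw
    have := b.sum_inner_mul_inner ⟨v, hv⟩ ⟨w, hw⟩
    simp only [Submodule.coe_inner] at this
    rw [← this]
    exact Finset.sum_congr rfl fun i _ => by rw [real_inner_comm]
  -- The `i`-th coordinate of `f x` is `⟨u i, φ x⟩`, so `∑ i, u i ⊗ u i` represents `‖f x‖²`. The
  -- sum of the `‖u i‖²` is exactly `‖f‖²`, with no dimensional factor.
  let u := fun i => ∑ j, inner ℝ (b i : H) (h j) • φ (z j)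
  have hu : ∀ i x, inner ℝ (u i) (φ x) = inner ℝ (b i : H) (f x) := by
    intro i x
    rw [hf, sum_inner, inner_sum]
    refine Finset.sum_congr rfl fun j _ => ?_
    rw [real_inner_smul_left, real_inner_smul_right, real_inner_comm (φ x), hφ, mul_comm]
  refine ⟨∑ i, u i ⊗ₜ[ℝ] u i, ?_, fun x => ?_⟩
  · calc _ ≤ ∑ i, ‖u i ⊗ₜ[ℝ] u i‖ := norm_sum_le _ _
      _ = ∑ i, ∑ j, inner ℝ (b i : H) (h j) * inner ℝ (b i : H) (f (z j)) := by
        refine Finset.sum_congr rfl fun i _ => ?_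
        rw [TensorProduct.norm_tmul, ← real_inner_self_eq_norm_mul_norm]
        conv_lhs => rw [show inner ℝ (u i) (u i) = inner ℝ (u i)
          (∑ j, inner ℝ (b i : H) (h j) • φ (z j)) from rfl, inner_sum]
        exact Finset.sum_congr rfl fun j _ => by rw [real_inner_smul_right, hu]
      _ = ∑ j, inner ℝ (h j) (f (z j)) := by
        rw [Finset.sum_comm]
        exact Finset.sum_congr rfl fun j _ => (hb _ (hS j) _ (hfS _)).symm
      _ = inner ℝ f f := by
        conv_rhs => rw [show inner ℝ f f = inner ℝ (∑ j, RKHS.kerFun G (z j) (h j)) f from rfl,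
          sum_inner]
        exact Finset.sum_congr rfl fun j _ => (RKHS.kerFun_inner _ _ _).symm
      _ = ‖f‖ ^ 2 := real_inner_self_eq_norm_sq f
      _ ≤ _ := le_rfl
  · rw [sum_inner, ← real_inner_self_eq_norm_sq, hb _ (hfS x) _ (hfS x)]
    refine Finset.sum_congr rfl fun i _ => ?_
    rw [TensorProduct.inner_tmul, hu]

theorem exists_seq_sum_kerFun_tendsto (f : G) :
    ∃ s : ℕ → G, (∀ m, ∃ (r : ℕ) (z : Fin r → X) (h : Fin r → H),
      s m = ∑ j, RKHS.kerFun G (z j) (h j)) ∧ Filter.Tendsto s Filter.atTop (nhds f) := by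
  have hf : f ∈ closure ((Submodule.span ℝ {RKHS.kerFun G x v | (x : X) (v : H)} :
      Submodule ℝ G) : Set G) := by
    rw [← Submodule.topologicalClosure_coe, RKHS.kerFun_dense]
    trivial
  obtain ⟨s, hs, hlim⟩ := mem_closure_iff_seq_limit.1 hf
  refine ⟨s, fun m => ?_, hlim⟩
  obtain ⟨r, c, g, hg⟩ := Submodule.mem_span_set'.1 (hs m)
  choose z v hzv using fun j => (g j).2
  refine ⟨r, z, fun j => c j • v j, ?_⟩
  rw [← hg]
  refine Finset.sum_congr rfl fun j _ => ?_
  rw [map_smul, hzv]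

end RKHS

/-! ### Uniform deviation between empirical and population second moments. -/

section Deviation

variable {X H G F : Type*} [NormedAddCommGroup H] [InnerProductSpace ℝ H] [CompleteSpace H]
  [NormedAddCommGroup G] [InnerProductSpace ℝ G] [CompleteSpace G] [RKHS ℝ G X H]
  [NormedAddCommGroup F] [InnerProductSpace ℝ F]
  {k : X → X → ℝ}

/-- The tensor square of a feature map, in the completed tensor product. -/
noncomputable def tensorSquare (φ : X → F) (x : X) : UniformSpace.Completion (F ⊗[ℝ] F) :=
  ((φ x ⊗ₜ[ℝ] φ x : F ⊗[ℝ] F) : UniformSpace.Completion (F ⊗[ℝ] F))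

theorem continuous_tensorSquare [TopologicalSpace X] {φ : X → F} (hφ : Continuous φ) :
    Continuous (tensorSquare φ) :=
  (UniformSpace.Completion.continuous_coe _).comp
    (TensorProduct.continuous_tmul.comp (hφ.prodMk hφ))

theorem norm_tensorSquare (φ : X → F) (x : X) : ‖tensorSquare φ x‖ = ‖φ x‖ ^ 2 := by
  rw [tensorSquare, UniformSpace.Completion.norm_coe, TensorProduct.norm_tmul, sq]

/-- Uniform deviation bound: the difference between the `L²` norms of `f` with respect to two
measures is controlled by the difference of the mean embeddings of the tensor square. -/
theorem integral_norm_sq_sub_le [TopologicalSpace X] [SecondCountableTopology X]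
    [MeasurableSpace X] [OpensMeasurableSpace X]
    (hG : RKHS.kernel G = separableKernel H k)
    (hk : Continuous fun p : X × X => k p.1 p.2) {κ : ℝ} (hκ : 0 ≤ κ)
    (hkb : ∀ x, k x x ≤ κ ^ 2)
    {φ : X → F} (hφ : ∀ x x', inner ℝ (φ x) (φ x') = k x x') (hφc : Continuous φ)
    (μ : Measure X) [IsProbabilityMeasure μ] {n : ℕ} (x : Fin n → X) (f : G) :
    ∫ t, ‖f t‖ ^ 2 ∂μ - (n : ℝ)⁻¹ * ∑ i, ‖f (x i)‖ ^ 2 ≤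
      ‖∫ t, tensorSquare φ t ∂μ - (n : ℝ)⁻¹ • ∑ i, tensorSquare φ (x i)‖ * ‖f‖ ^ 2 := by
  set D := ∫ t, tensorSquare φ t ∂μ - (n : ℝ)⁻¹ • ∑ i, tensorSquare φ (x i)
  have hφn : ∀ t, ‖φ t‖ ^ 2 ≤ κ ^ 2 := fun t => by
    rw [← real_inner_self_eq_norm_sq, hφ]; exact hkb t
  have hint : Integrable (tensorSquare φ) μ :=
    Integrable.of_bound (continuous_tensorSquare hφc).stronglyMeasurable.aestronglyMeasurable
      (κ ^ 2) (ae_of_all _ fun t => by rw [norm_tensorSquare]; exact hφn t)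
  -- The tensor representation is available for finite kernel combinations; the inequality,
  -- quadratic in `f`, passes to limits in norm.
  obtain ⟨s, hs, hlim⟩ := exists_seq_sum_kerFun_tendsto (G := G) (X := X) f
  have hfin : ∀ m, ∫ t, ‖s m t‖ ^ 2 ∂μ - (n : ℝ)⁻¹ * ∑ i, ‖s m (x i)‖ ^ 2 ≤ ‖D‖ * ‖s m‖ ^ 2 := by
    intro m
    obtain ⟨r, z, h, hm⟩ := hs m
    obtain ⟨W, hW, hWe⟩ := exists_tensor_inner_eq_norm_sq_sum_kerFun (G := G) hG hφ z h
    rw [← hm] at hW hWe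
    have hWe' : ∀ t, ‖s m t‖ ^ 2 =
        inner ℝ (W : UniformSpace.Completion (F ⊗[ℝ] F)) (tensorSquare φ t) := fun t => by
      rw [← hWe, tensorSquare, UniformSpace.Completion.inner_coe]
    have he : ∫ t, ‖s m t‖ ^ 2 ∂μ - (n : ℝ)⁻¹ * ∑ i, ‖s m (x i)‖ ^ 2 =
        inner ℝ (W : UniformSpace.Completion (F ⊗[ℝ] F)) D := by
      simp only [hWe', D]
      rw [integral_inner hint, inner_sub_right, real_inner_smul_right, inner_sum]
    rw [he, mul_comm]
    refine (real_inner_le_norm _ _).trans ?_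
    rw [UniformSpace.Completion.norm_coe]
    gcongr
  have hpt : ∀ t, Filter.Tendsto (fun m => ‖s m t‖ ^ 2) Filter.atTop (nhds (‖f t‖ ^ 2)) :=
    fun t => ((((RKHS.continuous_eval (H := G) t).tendsto f).comp hlim).norm).pow 2
  obtain ⟨C, hC⟩ := hlim.norm.bddAbove_range
  have hC' : ∀ m, ‖s m‖ ≤ C := fun m => hC ⟨m, rfl⟩
  have hL : Filter.Tendsto (fun m => ∫ t, ‖s m t‖ ^ 2 ∂μ) Filter.atTop
      (nhds (∫ t, ‖f t‖ ^ 2 ∂μ)) := by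
    refine tendsto_integral_of_dominated_convergence (fun _ => (κ * C) ^ 2) (fun m => ?_)
      (integrable_const _) (fun m => ae_of_all _ fun t => ?_) (ae_of_all _ hpt)
    · have := continuous_coe_of_kernel_eq hG hk (s m)
      have h2 : Continuous fun t => ‖s m t‖ ^ 2 := by fun_prop
      exact h2.stronglyMeasurable.aestronglyMeasurable
    · rw [Real.norm_of_nonneg (by positivity)]
      gcongr
      exact (norm_apply_le_of_kernel_eq hG hκ hkb (s m) t).trans
        (mul_le_mul_of_nonneg_left (hC' m) hκ)
  exact le_of_tendsto_of_tendsto'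
    (hL.sub ((tendsto_finsetSum _ fun i _ => hpt (x i)).const_mul _))
    ((hlim.norm.pow 2).const_mul _) hfin

end Deviation

/-! ### The surrogate minimizer as a conditional mean. -/

theorem integral_norm_sq_le_of_surrogateRisk_le {X Y : Type*} [MeasurableSpace X]
    [MeasurableSpace Y] {H : Type*} [NormedAddCommGroup H] {ρ : Measure (X × Y)}
    [IsProbabilityMeasure ρ] {ψ : Y → H} {g g' : X → H} {C C' : ℝ}
    (hm : StronglyMeasurable fun p : X × Y => g p.1 - ψ p.2)
    (hm' : StronglyMeasurable fun p : X × Y => g' p.1 - ψ p.2)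
    (hb : ∀ p : X × Y, ‖g p.1 - ψ p.2‖ ≤ C) (hb' : ∀ p : X × Y, ‖g' p.1 - ψ p.2‖ ≤ C')
    (h : surrogateRisk ρ ψ g ≤ surrogateRisk ρ ψ g') :
    ∫ p, ‖g p.1 - ψ p.2‖ ^ 2 ∂ρ ≤ ∫ p, ‖g' p.1 - ψ p.2‖ ^ 2 ∂ρ := by
  have key : ∀ (g : X → H) (C : ℝ), StronglyMeasurable (fun p : X × Y => g p.1 - ψ p.2) →
      (∀ p : X × Y, ‖g p.1 - ψ p.2‖ ≤ C) →
      surrogateRisk ρ ψ g = ENNReal.ofReal (∫ p, ‖g p.1 - ψ p.2‖ ^ 2 ∂ρ) := by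
    intro g C hm hb
    rw [ofReal_integral_eq_lintegral_ofReal]
    · refine lintegral_congr fun p => ?_
      rw [ENNReal.ofReal_pow (norm_nonneg _), ofReal_norm]
    · refine Integrable.of_bound (hm.norm.pow 2).aestronglyMeasurable (C ^ 2)
        (ae_of_all _ fun p => ?_)
      rw [Real.norm_of_nonneg (by positivity)]
      gcongr
      exact hb p
    · exact ae_of_all _ fun p => by positivity
  rw [key g C hm hb, key g' C' hm' hb'] at h
  exact (ENNReal.ofReal_le_ofReal_iff (integral_nonneg fun p => by positivity)).1 h

/-- A bounded minimizer of the surrogate risk is the conditional mean of `ψ`: its residual is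
orthogonal to every bounded function of the input. -/
theorem integral_inner_residual_eq_zero {X Y : Type*} [MeasurableSpace X] [MeasurableSpace Y]
    {H : Type*} [NormedAddCommGroup H] [InnerProductSpace ℝ H] {ρ : Measure (X × Y)}
    [IsProbabilityMeasure ρ] {ψ : Y → H} (hψ : StronglyMeasurable ψ) {Q : ℝ}
    (hQ : ∀ y, ‖ψ y‖ ≤ Q) {g : X → H} (hg : IsSurrogateMinimizer ρ ψ g) {C : ℝ}
    (hC : ∀ x, ‖g x‖ ≤ C) {h : X → H} (hh : StronglyMeasurable h) {B : ℝ}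
    (hB : ∀ x, ‖h x‖ ≤ B) :
    ∫ p, inner ℝ (h p.1) (ψ p.2 - g p.1) ∂ρ = 0 := by
  obtain ⟨hgm, hmin⟩ := hg
  have hr : StronglyMeasurable fun p : X × Y => g p.1 - ψ p.2 :=
    (hgm.comp_measurable measurable_fst).sub (hψ.comp_measurable measurable_snd)
  have hrb : ∀ p : X × Y, ‖g p.1 - ψ p.2‖ ≤ C + Q := fun p =>
    (norm_sub_le _ _).trans (add_le_add (hC _) (hQ _))
  have hh1 : StronglyMeasurable fun p : X × Y => h p.1 := hh.comp_measurable measurable_fst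
  have hi1 : Integrable (fun p : X × Y => ‖g p.1 - ψ p.2‖ ^ 2) ρ := by
    refine Integrable.of_bound (hr.norm.pow 2).aestronglyMeasurable ((C + Q) ^ 2)
      (ae_of_all _ fun p => ?_)
    rw [Real.norm_of_nonneg (by positivity)]
    gcongr
    exact hrb p
  have hi2 : Integrable (fun p : X × Y => ‖h p.1‖ ^ 2) ρ := by
    refine Integrable.of_bound (hh1.norm.pow 2).aestronglyMeasurable (B ^ 2)
      (ae_of_all _ fun p => ?_)
    rw [Real.norm_of_nonneg (by positivity)]
    gcongr
    exact hB _
  have hi3 : Integrable (fun p : X × Y => inner ℝ (h p.1) (g p.1 - ψ p.2)) ρ := by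
    refine Integrable.of_bound (hh1.inner hr).aestronglyMeasurable (B * (C + Q))
      (ae_of_all _ fun p => (norm_inner_le_norm _ _).trans ?_)
    have := norm_nonneg (h p.1)
    exact mul_le_mul (hB _) (hrb p) (norm_nonneg _) (this.trans (hB _))
  -- First variation: the risk of `g + t • h` is a quadratic polynomial in `t`, minimal at `t = 0`.
  have key : ∀ t : ℝ, 0 ≤ 2 * t * ∫ p, inner ℝ (h p.1) (g p.1 - ψ p.2) ∂ρ +
      t ^ 2 * ∫ p, ‖h p.1‖ ^ 2 ∂ρ := by
    intro t
    have hm' : StronglyMeasurable fun p : X × Y => (g + t • h) p.1 - ψ p.2 :=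
      ((hgm.add (hh.const_smul t)).comp_measurable measurable_fst).sub
        (hψ.comp_measurable measurable_snd)
    have hle := integral_norm_sq_le_of_surrogateRisk_le (C' := C + |t| * B + Q) hr hm' hrb
      (fun p => (norm_sub_le _ _).trans (add_le_add ((norm_add_le _ _).trans
        (add_le_add (hC _) (by
          rw [Pi.smul_apply, norm_smul, Real.norm_eq_abs]
          exact mul_le_mul_of_nonneg_left (hB _) (abs_nonneg t)))) (hQ _)))
      (hmin _ (hgm.add (hh.const_smul t)))
    have he : ∀ p : X × Y, ‖(g + t • h) p.1 - ψ p.2‖ ^ 2 = ‖g p.1 - ψ p.2‖ ^ 2 +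
        (2 * t * inner ℝ (h p.1) (g p.1 - ψ p.2) + t ^ 2 * ‖h p.1‖ ^ 2) := by
      intro p
      have : (g + t • h) p.1 - ψ p.2 = (g p.1 - ψ p.2) + t • h p.1 := by
        simp only [Pi.add_apply, Pi.smul_apply]; abel
      rw [this, norm_add_sq_real, real_inner_smul_right, norm_smul, mul_pow, Real.norm_eq_abs,
        sq_abs, real_inner_comm]
      ring
    simp only [he] at hle
    have hi4 : Integrable (fun p : X × Y => 2 * t * inner ℝ (h p.1) (g p.1 - ψ p.2) +
        t ^ 2 * ‖h p.1‖ ^ 2) ρ := (hi3.const_mul _).add (hi2.const_mul _)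
    rw [integral_add hi1 hi4,
      integral_add (hi3.const_mul _) (hi2.const_mul _), integral_const_mul,
      integral_const_mul] at hle
    linarith
  set a := ∫ p, inner ℝ (h p.1) (g p.1 - ψ p.2) ∂ρ with ha
  set b := ∫ p, ‖h p.1‖ ^ 2 ∂ρ
  have hb0 : 0 ≤ b := integral_nonneg fun p => by positivity
  have ha0 : a = 0 := by
    -- The `+ 1` avoids a separate treatment of `b = 0`.
    have h1 := key (-(a / (b + 1)))
    have hb1 : 0 < b + 1 := by positivity
    have h2 : 2 * -(a / (b + 1)) * a + (-(a / (b + 1))) ^ 2 * b =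
        -(a ^ 2 * (b + 2) / (b + 1) ^ 2) := by field_simp; ring
    rw [h2] at h1
    by_contra hne
    have : 0 < a ^ 2 * (b + 2) / (b + 1) ^ 2 := by positivity
    linarith
  have : ∀ p : X × Y, inner ℝ (h p.1) (ψ p.2 - g p.1) = -inner ℝ (h p.1) (g p.1 - ψ p.2) :=
    fun p => by rw [← inner_neg_right, neg_sub]
  simp only [this, integral_neg]
  rw [← ha, ha0, neg_zero]

/-! ### Energy identity for kernel ridge regression. -/

/-- The kernel ridge regression estimator with the given weights minus an element `g` of the
reproducing kernel Hilbert space is an element satisfying an energy identity. -/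
theorem exists_ridge_error {X H G : Type*} [NormedAddCommGroup H] [InnerProductSpace ℝ H]
    [CompleteSpace H] [NormedAddCommGroup G] [InnerProductSpace ℝ G] [CompleteSpace G]
    [RKHS ℝ G X H] {k : X → X → ℝ} (hG : RKHS.kernel G = separableKernel H k)
    (hk : IsReproducingKernel k) {n : ℕ} (hn : 1 ≤ n) {lam : ℝ} (hlam : 0 < lam)
    (x : Fin n → X) (v : Fin n → H) (g : G) :
    ∃ δ : G, (∀ t, ∑ i, weights k lam x t i • v i = g t + δ t) ∧
      lam * ‖δ‖ ^ 2 + (n : ℝ)⁻¹ * ∑ i, ‖δ (x i)‖ ^ 2 =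
        inner ℝ δ ((n : ℝ)⁻¹ • ∑ i, RKHS.kerFun G (x i) (v i - g (x i))) -
          lam * inner ℝ δ g := by
  have hn0 : (0 : ℝ) < n := by exact_mod_cast hn
  set A : Matrix (Fin n) (Fin n) ℝ :=
    (Matrix.of fun i j => k (x i) (x j)) + ((n : ℝ) * lam) • (1 : Matrix (Fin n) (Fin n) ℝ) with hA
  have hK : (Matrix.of fun i j => k (x i) (x j)).PosSemidef := hk.submatrix x
  have hpos : A.PosDef :=
    Matrix.PosDef.posSemidef_add hK (Matrix.PosDef.one.smul (mul_pos hn0 hlam))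
  have hunit : IsUnit A.det := hpos.det_pos.ne'.isUnit
  have hsymm : ∀ i j, A i j = A j i := fun i j => by simpa using hpos.1.apply j i
  set w : Fin n → H := fun j => ∑ i, A⁻¹ i j • v i with hw
  have hAw : ∀ j, ∑ l, A j l • w l = v j := by
    intro j
    simp only [hw, Finset.smul_sum, smul_smul]
    rw [Finset.sum_comm]
    have : ∀ i, ∑ l, A j l * A⁻¹ i l = (1 : Matrix (Fin n) (Fin n) ℝ) i j := by
      intro i
      rw [← Matrix.nonsing_inv_mul A hunit, Matrix.mul_apply]
      exact Finset.sum_congr rfl fun l _ => by rw [hsymm j l, mul_comm]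
    simp only [← Finset.sum_smul, this, Matrix.one_apply, ite_smul, one_smul, zero_smul]
    simp
  set gh : G := ∑ j, RKHS.kerFun G (x j) (w j) with hgh
  have hgh_apply : ∀ t, gh t = ∑ j, k t (x j) • w j := by
    intro t
    rw [← RKHS.adjoint_kerFun, map_sum]
    refine Finset.sum_congr rfl fun j _ => ?_
    rw [RKHS.adjoint_kerFun, kerFun_apply_of_kernel_eq hG]
  -- Normal equations: the representer coefficients are the scaled training residuals.
  have hw_eq : ∀ j, ((n : ℝ) * lam) • w j = v j - gh (x j) := by
    intro j
    rw [eq_sub_iff_add_eq', hgh_apply]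
    conv_rhs => rw [← hAw j]
    simp only [hA, Matrix.add_apply, Matrix.of_apply, Matrix.smul_apply, add_smul,
      Finset.sum_add_distrib, Matrix.one_apply, smul_eq_mul, mul_ite, mul_one, mul_zero,
      ite_smul, zero_smul]
    simp
  have hd : ∀ t, (gh - g) t = gh t - g t := fun t => by rw [RKHS.coe_sub]; rfl
  refine ⟨gh - g, fun t => ?_, ?_⟩
  · rw [hd, add_sub_cancel, hgh_apply]
    simp only [weights, Matrix.mulVec, dotProduct, hw, Finset.smul_sum, smul_smul,
      Finset.sum_smul]
    rw [Finset.sum_comm]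
    refine Finset.sum_congr rfl fun j _ => Finset.sum_congr rfl fun i _ => ?_
    rw [mul_comm]
  · set δ := gh - g
    have h1 : lam * inner ℝ δ gh = (n : ℝ)⁻¹ * ∑ j, inner ℝ (δ (x j)) (v j - gh (x j)) := by
      rw [hgh, inner_sum, Finset.mul_sum, Finset.mul_sum]
      refine Finset.sum_congr rfl fun j _ => ?_
      rw [RKHS.inner_kerFun, ← hgh, ← hw_eq, real_inner_smul_right]
      field_simp
    have h2 : ‖δ‖ ^ 2 = inner ℝ δ gh - inner ℝ δ g := by
      rw [← inner_sub_right, real_inner_self_eq_norm_sq]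
    have h3 : ∀ j, ‖δ (x j)‖ ^ 2 = inner ℝ (δ (x j)) (v j - g (x j)) -
        inner ℝ (δ (x j)) (v j - gh (x j)) := by
      intro j
      rw [← inner_sub_right, sub_sub_sub_cancel_left, ← hd, real_inner_self_eq_norm_sq]
    rw [real_inner_smul_right, inner_sum]
    simp only [RKHS.inner_kerFun, h3, Finset.sum_sub_distrib, h2]
    rw [mul_sub, h1]
    ring

/-! ### Comparison of excess risk with `L²` error. -/

theorem integral_norm_le_sqrt_integral_norm_sq {Z : Type*} [MeasurableSpace Z] {μ : Measure Z}
    [IsProbabilityMeasure μ] {f : Z → ℝ} (hf : Integrable f μ)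
    (hf2 : Integrable (fun z => f z ^ 2) μ) : ∫ z, f z ∂μ ≤ √(∫ z, f z ^ 2 ∂μ) := by
  apply Real.le_sqrt_of_sq_le
  set c := ∫ z, f z ∂μ with hc
  have h : 0 ≤ ∫ z, (f z - c) ^ 2 ∂μ := integral_nonneg fun z => sq_nonneg _
  have he : ∀ z, (f z - c) ^ 2 = f z ^ 2 - (2 * c * f z - c ^ 2) := fun z => by ring
  simp only [he] at h
  have hi : Integrable (fun z => 2 * c * f z - c ^ 2) μ :=
    (hf.const_mul _).sub (integrable_const _)
  rw [integral_sub hf2 hi,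
    integral_sub (hf.const_mul _) (integrable_const _), integral_const_mul, ← hc] at h
  simp at h
  nlinarith

/-- Comparison inequality: the excess risk of the decoding of `g + δ`, with `g` a minimizer of the
surrogate risk, is controlled by the `L²` norm of `δ`. -/
theorem risk_sub_le_sqrt_integral_norm_sq {X Y : Type*} [MeasurableSpace X] [MeasurableSpace Y]
    {H : Type*} [NormedAddCommGroup H] [InnerProductSpace ℝ H] [CompleteSpace H]
    {ρ : Measure (X × Y)} [IsProbabilityMeasure ρ] {Δ : Y → Y → ℝ} {ψ : Y → H}
    (hψ : StronglyMeasurable ψ) {Q : ℝ} (hQ : ∀ y, ‖ψ y‖ ≤ Q) (V : H →L[ℝ] H)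
    (hΔ : ∀ y y' : Y, Δ y y' = inner ℝ (ψ y) (V (ψ y'))) {g : X → H}
    (hg : IsSurrogateMinimizer ρ ψ g) {C : ℝ} (hC : ∀ x, ‖g x‖ ≤ C) {δ : X → H}
    (hδ : StronglyMeasurable δ) {B : ℝ} (hB : ∀ x, ‖δ x‖ ≤ B) {f f' : X → Y}
    (hf : Measurable f) (hf' : Measurable f')
    (hmin : ∀ x y, inner ℝ (ψ (f x)) (V (g x + δ x)) ≤ inner ℝ (ψ y) (V (g x + δ x))) :
    risk ρ Δ f - risk ρ Δ f' ≤ 2 * Q * ‖V‖ * √(∫ p, ‖δ p.1‖ ^ 2 ∂ρ) := by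
  have hint : ∀ f : X → Y, Measurable f → Integrable (fun p : X × Y => Δ (f p.1) p.2) ρ := by
    intro f hf
    simp only [hΔ]
    refine Integrable.of_bound (C := Q * (‖V‖ * Q)) (StronglyMeasurable.inner
      (hψ.comp_measurable (hf.comp measurable_fst))
      (V.continuous.comp_stronglyMeasurable (hψ.comp_measurable measurable_snd))).aestronglyMeasurable
      (ae_of_all _ fun p => (norm_inner_le_norm _ _).trans ?_)
    have := (norm_nonneg (ψ p.2)).trans (hQ p.2)
    exact mul_le_mul (hQ _) ((V.le_opNorm _).trans
      (mul_le_mul_of_nonneg_left (hQ _) (norm_nonneg _))) (norm_nonneg _) this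
  have hd : StronglyMeasurable fun x => ψ (f x) - ψ (f' x) :=
    (hψ.comp_measurable hf).sub (hψ.comp_measurable hf')
  have hdb : ∀ x, ‖ψ (f x) - ψ (f' x)‖ ≤ 2 * Q := fun x =>
    (norm_sub_le _ _).trans (by linarith [hQ (f x), hQ (f' x)])
  have hzero := integral_inner_residual_eq_zero (ρ := ρ) hψ hQ hg hC
    (h := fun x => V.adjoint (ψ (f x) - ψ (f' x)))
    (V.adjoint.continuous.comp_stronglyMeasurable hd) (B := ‖V.adjoint‖ * (2 * Q))
    (fun x => (V.adjoint.le_opNorm _).trans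
      (mul_le_mul_of_nonneg_left (hdb x) (norm_nonneg _)))
  have hδ1 : Integrable (fun p : X × Y => ‖δ p.1‖) ρ :=
    Integrable.of_bound (hδ.comp_measurable measurable_fst).norm.aestronglyMeasurable B
      (ae_of_all _ fun p => by rw [norm_norm]; exact hB _)
  have hδ2 : Integrable (fun p : X × Y => ‖δ p.1‖ ^ 2) ρ :=
    Integrable.of_bound ((hδ.comp_measurable measurable_fst).norm.pow 2).aestronglyMeasurable
      (B ^ 2) (ae_of_all _ fun p => by
        rw [Real.norm_of_nonneg (by positivity)]
        gcongr
        exact hB _)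
  obtain ⟨p₀⟩ : Nonempty (X × Y) := nonempty_of_isProbabilityMeasure ρ
  have hQ0 : 0 ≤ Q := (norm_nonneg (ψ p₀.2)).trans (hQ _)
  -- The subtracted term, of integral zero, replaces `ψ y` by `g x`. Replacing `g x` by `g x + δ x`
  -- costs the right-hand side, and what remains is nonpositive by `hmin`.
  have hpt : ∀ p : X × Y, Δ (f p.1) p.2 - Δ (f' p.1) p.2 -
      inner ℝ (V.adjoint (ψ (f p.1) - ψ (f' p.1))) (ψ p.2 - g p.1) ≤ 2 * Q * ‖V‖ * ‖δ p.1‖ := by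
    rintro ⟨x, y⟩
    have h1 : Δ (f x) y - Δ (f' x) y -
        inner ℝ (V.adjoint (ψ (f x) - ψ (f' x))) (ψ y - g x) =
        inner ℝ (ψ (f x)) (V (g x + δ x)) - inner ℝ (ψ (f' x)) (V (g x + δ x)) +
          inner ℝ (ψ (f x) - ψ (f' x)) (-V (δ x)) := by
      simp only [hΔ, ContinuousLinearMap.adjoint_inner_left, map_sub, map_add, inner_sub_left,
        inner_sub_right, inner_add_right, inner_neg_right]
      ring
    have h2 := hmin x (f' x)
    have h3 : inner ℝ (ψ (f x) - ψ (f' x)) (-V (δ x)) ≤ 2 * Q * (‖V‖ * ‖δ x‖) := by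
      refine (real_inner_le_norm _ _).trans ?_
      rw [norm_neg]
      exact mul_le_mul (hdb x) (V.le_opNorm _) (norm_nonneg _) (by positivity)
    simp only
    linarith
  have hires : Integrable (fun p : X × Y =>
      inner ℝ (V.adjoint (ψ (f p.1) - ψ (f' p.1))) (ψ p.2 - g p.1)) ρ := by
    refine Integrable.of_bound (C := ‖V.adjoint‖ * (2 * Q) * (Q + C)) (StronglyMeasurable.inner
      (V.adjoint.continuous.comp_stronglyMeasurable (hd.comp_measurable measurable_fst))
      ((hψ.comp_measurable measurable_snd).sub
        (hg.1.comp_measurable measurable_fst))).aestronglyMeasurable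
      (ae_of_all _ fun p => (norm_inner_le_norm _ _).trans ?_)
    exact mul_le_mul ((V.adjoint.le_opNorm _).trans
      (mul_le_mul_of_nonneg_left (hdb _) (norm_nonneg _)))
      ((norm_sub_le _ _).trans (add_le_add (hQ _) (hC _))) (norm_nonneg _) (by positivity)
  have hsub : Integrable (fun p : X × Y => Δ (f p.1) p.2 - Δ (f' p.1) p.2) ρ :=
    (hint f hf).sub (hint f' hf')
  calc risk ρ Δ f - risk ρ Δ f' = ∫ p, (Δ (f p.1) p.2 - Δ (f' p.1) p.2 -
        inner ℝ (V.adjoint (ψ (f p.1) - ψ (f' p.1))) (ψ p.2 - g p.1)) ∂ρ := by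
        rw [integral_sub hsub hires, hzero, sub_zero,
          integral_sub (hint f hf) (hint f' hf')]
        rfl
    _ ≤ ∫ p, 2 * Q * ‖V‖ * ‖δ p.1‖ ∂ρ :=
        integral_mono (hsub.sub hires) (hδ1.const_mul _) hpt
    _ ≤ _ := by
        rw [integral_const_mul]
        exact mul_le_mul_of_nonneg_left (integral_norm_le_sqrt_integral_norm_sq hδ1 hδ2)
          (by positivity)

/-! ### Assembly of the learning rate. -/

/-- For `τ ≥ 2` one has `τ + 1 / 2 ≤ τ ^ 2`, which trades the sub-Gaussian `√τ` for a cleaner factor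
`τ`. -/
theorem norm_inv_smul_le_of_sq_le {E : Type*} [NormedAddCommGroup E] [NormedSpace ℝ E] {S : E}
    {n : ℕ} (hn : 1 ≤ n) {lam M τ : ℝ} (hlam : 0 < lam) (hlam2 : lam ^ 2 = (n : ℝ)⁻¹)
    (hM : 0 < M) (hτ : 2 ≤ τ) (hS : ‖S‖ ^ 2 ≤ 4 * M ^ 2 * n * (τ + 1 / 2)) :
    ‖(n : ℝ)⁻¹ • S‖ ≤ 2 * M * τ * lam := by
  have hn0 : (0 : ℝ) < n := by exact_mod_cast hn
  refine (sq_le_sq₀ (norm_nonneg _) (by positivity)).1 ?_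
  rw [norm_smul, mul_pow, Real.norm_of_nonneg (by positivity)]
  calc (n : ℝ)⁻¹ ^ 2 * ‖S‖ ^ 2 ≤ (n : ℝ)⁻¹ ^ 2 * (4 * M ^ 2 * n * (τ + 1 / 2)) := by gcongr
    _ ≤ (n : ℝ)⁻¹ ^ 2 * (4 * M ^ 2 * n * τ ^ 2) := by gcongr; nlinarith
    _ = (2 * M * τ * lam) ^ 2 := by rw [mul_pow _ lam, hlam2]; field_simp; ring

/-- The deterministic part of the error analysis. -/
theorem sqrt_le_of_energy_bound {lam τ d m e a s C M J I : ℝ} (hlam : 0 < lam) (hτ : 2 ≤ τ)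
    (hd : 0 ≤ d) (hm : 0 ≤ m) (hC : 0 ≤ C) (hM : 0 ≤ M)
    (hen : lam * d ^ 2 + m ≤ d * e + lam * (d * a)) (ha : 0 ≤ a)
    (he : e ≤ s * τ * lam) (hCs : C = s + a) (hI : I - m ≤ J * d ^ 2)
    (hJ : J ≤ M * τ * lam) :
    √I ≤ C * (1 + M) * τ ^ 2 * √lam := by
  have h1 : lam * d ^ 2 + m ≤ lam * τ * C * d := by
    calc _ ≤ d * e + lam * (d * a) := hen
      _ ≤ d * (s * τ * lam) + lam * (d * (a * τ)) := by
          gcongr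
          nlinarith
      _ = _ := by rw [hCs]; ring
  -- Drop `m` and divide by `lam * d`; this bound is then fed back to bound `m`.
  have h2 : d ≤ C * τ := by
    rcases hd.eq_or_lt with h | h
    · rw [← h]; positivity
    · have : lam * d * d ≤ lam * d * (C * τ) := by nlinarith
      exact le_of_mul_le_mul_left this (by positivity)
  have h3 : m ≤ lam * τ ^ 2 * C ^ 2 := by
    calc m ≤ lam * τ * C * d := by nlinarith [mul_nonneg hlam.le (sq_nonneg d)]
      _ ≤ lam * τ * C * (C * τ) := by gcongr
      _ = _ := by ring
  have h4 : J * d ^ 2 ≤ M * τ * lam * (C * τ) ^ 2 := by gcongr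
  apply Real.sqrt_le_iff.2
  refine ⟨by positivity, ?_⟩
  rw [mul_pow, Real.sq_sqrt hlam.le]
  have hA : 0 ≤ lam * C ^ 2 := by positivity
  have hτ1 : τ ^ 2 ≤ τ ^ 4 := pow_le_pow_right₀ (by linarith) (by norm_num)
  have hτ2 : τ ^ 3 ≤ τ ^ 4 := pow_le_pow_right₀ (by linarith) (by norm_num)
  calc I ≤ lam * C ^ 2 * (τ ^ 2 + M * τ ^ 3) := by linarith
    _ ≤ lam * C ^ 2 * (τ ^ 4 + M * τ ^ 4) := by gcongr
    _ ≤ lam * C ^ 2 * ((1 + M) ^ 2 * τ ^ 4) := by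
        have h4 : 0 ≤ τ ^ 4 := by positivity
        gcongr
        nlinarith [mul_nonneg hM h4, mul_nonneg (mul_nonneg hM hM) h4]
    _ = _ := by ring

/-- A union bound; one event serves both the regression noise and the tensor-square deviation. -/
theorem exists_measurableSet_norm_sum_sq_le {Z : Type*} [MeasurableSpace Z] {μ : Measure Z}
    [IsProbabilityMeasure μ] {E E' : Type*} [NormedAddCommGroup E] [InnerProductSpace ℝ E]
    [CompleteSpace E] [NormedAddCommGroup E'] [InnerProductSpace ℝ E'] [CompleteSpace E']
    {ξ : Z → E} (hξ : StronglyMeasurable ξ) {M : ℝ} (hM : 0 < M)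
    (hb : ∀ z, ‖ξ z‖ ≤ M) (h0 : ∫ z, ξ z ∂μ = 0)
    {ξ' : Z → E'} (hξ' : StronglyMeasurable ξ') {M' : ℝ} (hM' : 0 < M')
    (hb' : ∀ z, ‖ξ' z‖ ≤ M') (h0' : ∫ z, ξ' z ∂μ = 0) {n : ℕ} (hn : 1 ≤ n) (τ : ℝ) :
    ∃ A : Set (Fin n → Z), MeasurableSet A ∧
      1 - 2 * Real.exp (-τ) ≤ (Measure.pi fun _ : Fin n => μ).real A ∧
      ∀ z ∈ A, ‖∑ i, ξ (z i)‖ ^ 2 ≤ 4 * M ^ 2 * n * (τ + 1 / 2) ∧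
        ‖∑ i, ξ' (z i)‖ ^ 2 ≤ 4 * M' ^ 2 * n * (τ + 1 / 2) := by
  set P := Measure.pi fun _ : Fin n => μ
  set B : Set (Fin n → Z) := {z | 4 * M ^ 2 * n * (τ + 1 / 2) < ‖∑ i, ξ (z i)‖ ^ 2}
  set B' : Set (Fin n → Z) := {z | 4 * M' ^ 2 * n * (τ + 1 / 2) < ‖∑ i, ξ' (z i)‖ ^ 2}
  have hB : MeasurableSet B := measurableSet_lt measurable_const
    ((stronglyMeasurable_sum_comp_eval hξ n).norm.measurable.pow_const 2)
  have hB' : MeasurableSet B' := measurableSet_lt measurable_const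
    ((stronglyMeasurable_sum_comp_eval hξ' n).norm.measurable.pow_const 2)
  refine ⟨(B ∪ B')ᶜ, (hB.union hB').compl, ?_, fun z hz => ?_⟩
  · rw [probReal_compl_eq_one_sub (hB.union hB')]
    have h1 : P.real B ≤ _ := measureReal_norm_sum_sq_gt_le hξ hM hb h0 hn τ
    have h2 : P.real B' ≤ _ := measureReal_norm_sum_sq_gt_le hξ' hM' hb' h0' hn τ
    have h3 : P.real (B ∪ B') ≤ P.real B + P.real B' := measureReal_union_le B B'
    linarith
  · rw [Set.mem_compl_iff, Set.mem_union, not_or] at hz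
    exact ⟨not_lt.1 hz.1, not_lt.1 hz.2⟩

/-- Paired with `h` in `G`, the noise vector becomes `⟨h x, ψ y - g x⟩` by the reproducing property,
so its mean vanishes because the residual is orthogonal to functions of the input. -/
theorem integral_kerFun_residual_eq_zero {X Y : Type*} [TopologicalSpace X]
    [SecondCountableTopology X] [TopologicalSpace.PseudoMetrizableSpace X] [MeasurableSpace X]
    [BorelSpace X] [MeasurableSpace Y] {H G : Type*} [NormedAddCommGroup H]
    [InnerProductSpace ℝ H] [CompleteSpace H] [NormedAddCommGroup G] [InnerProductSpace ℝ G]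
    [CompleteSpace G] [RKHS ℝ G X H] {k : X → X → ℝ}
    (hG : RKHS.kernel G = separableKernel H k) (hk : Continuous fun p : X × X => k p.1 p.2)
    {κ : ℝ} (hκ : 0 ≤ κ) (hkb : ∀ x, k x x ≤ κ ^ 2) {ρ : Measure (X × Y)}
    [IsProbabilityMeasure ρ] {ψ : Y → H} (hψ : StronglyMeasurable ψ) {Q : ℝ}
    (hQ : ∀ y, ‖ψ y‖ ≤ Q) {g : X → H} (hg : IsSurrogateMinimizer ρ ψ g) {C : ℝ}
    (hC : ∀ x, ‖g x‖ ≤ C) :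
    StronglyMeasurable (fun p : X × Y => RKHS.kerFun G p.1 (ψ p.2 - g p.1)) ∧
      (∀ p : X × Y, ‖RKHS.kerFun G p.1 (ψ p.2 - g p.1)‖ ≤ κ * (Q + C)) ∧
      ∫ p, RKHS.kerFun G p.1 (ψ p.2 - g p.1) ∂ρ = 0 := by
  have hpair : StronglyMeasurable fun p : X × Y => (p.1, ψ p.2 - g p.1) :=
    (measurable_fst.stronglyMeasurable (f := fun p : X × Y => p.1)).prodMk
      ((hψ.comp_measurable measurable_snd).sub (hg.1.comp_measurable measurable_fst))
  have hcont : Continuous fun p : X × H => RKHS.kerFun G p.1 p.2 :=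
    continuous_kerFun_apply hG hk
  have hm : StronglyMeasurable (fun p : X × Y => RKHS.kerFun G p.1 (ψ p.2 - g p.1)) := by
    simpa only [Function.comp_def] using hcont.comp_stronglyMeasurable hpair
  have hb : ∀ p : X × Y, ‖RKHS.kerFun G p.1 (ψ p.2 - g p.1)‖ ≤ κ * (Q + C) := fun p =>
    (norm_kerFun_apply_le hG hκ hkb _ _).trans (mul_le_mul_of_nonneg_left
      ((norm_sub_le _ _).trans (add_le_add (hQ _) (hC _))) hκ)
  refine ⟨hm, hb, ?_⟩
  have hint : Integrable (fun p : X × Y => RKHS.kerFun G p.1 (ψ p.2 - g p.1)) ρ :=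
    Integrable.of_bound hm.aestronglyMeasurable _ (ae_of_all _ hb)
  refine ext_inner_left ℝ fun h => ?_
  rw [← integral_inner hint, inner_zero_right]
  simp only [RKHS.inner_kerFun]
  exact integral_inner_residual_eq_zero hψ hQ hg hC
    (continuous_coe_of_kernel_eq hG hk h).stronglyMeasurable
    (norm_apply_le_of_kernel_eq hG hκ hkb h)

/-- The learning rate, for an abstract model `G` of the vector-valued reproducing kernel Hilbert
space and a feature map `φ` of the scalar kernel. -/
theorem exists_learning_rate
    {X Y : Type*} [TopologicalSpace X] [SecondCountableTopology X]
    [TopologicalSpace.PseudoMetrizableSpace X] [MeasurableSpace X] [BorelSpace X]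
    [MeasurableSpace Y] {H G F : Type*} [NormedAddCommGroup H]
    [InnerProductSpace ℝ H] [CompleteSpace H] [NormedAddCommGroup G] [InnerProductSpace ℝ G]
    [CompleteSpace G] [RKHS ℝ G X H] [NormedAddCommGroup F] [InnerProductSpace ℝ F]
    {k : X → X → ℝ} (hG : RKHS.kernel G = separableKernel H k) (hk : IsReproducingKernel k)
    (hkc : Continuous fun p : X × X => k p.1 p.2) {κ : ℝ} (hκ : 0 ≤ κ)
    (hkb : ∀ x, k x x ≤ κ ^ 2) {φ : X → F} (hφ : ∀ x x', inner ℝ (φ x) (φ x') = k x x')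
    (ρ : Measure (X × Y)) [IsProbabilityMeasure ρ] {Δ : Y → Y → ℝ}
    {ψ : Y → H} (hψ : StronglyMeasurable ψ) {Q : ℝ} (hQ : ∀ y, ‖ψ y‖ ≤ Q) (V : H →L[ℝ] H)
    (hΔ : ∀ y y' : Y, Δ y y' = inner ℝ (ψ y) (V (ψ y'))) (g : G)
    (hg : IsSurrogateMinimizer ρ ψ g) :
    ∃ c : ℝ, ∀ n : ℕ, 1 ≤ n → ∀ τ : ℝ, 2 ≤ τ →
      ∃ A : Set (Fin n → X × Y), MeasurableSet A ∧
        1 - 2 * Real.exp (-τ) ≤ (Measure.pi fun _ : Fin n => ρ).real A ∧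
        ∀ z ∈ A, ∀ f : X → Y, IsAlgorithmOutput Δ k ((n : ℝ) ^ (-(1 / 2) : ℝ)) z f →
          ∀ f' : X → Y, Measurable f' →
            risk ρ Δ f - risk ρ Δ f' ≤ c * τ ^ 2 * (n : ℝ) ^ (-(1 / 4) : ℝ) := by
  have hφc := continuous_of_inner_eq hφ hkc
  obtain ⟨p₀⟩ : Nonempty (X × Y) := nonempty_of_isProbabilityMeasure ρ
  have hQ0 : 0 ≤ Q := (norm_nonneg (ψ p₀.2)).trans (hQ _)
  have hgC : ∀ x, ‖g x‖ ≤ κ * ‖g‖ := norm_apply_le_of_kernel_eq hG hκ hkb g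
  obtain ⟨hξm, hξb, hξ0⟩ := integral_kerFun_residual_eq_zero (G := G) hG hkc hκ hkb hψ hQ hg hgC
  -- The `+ 1` only ensures strict positivity, also when `κ = 0`.
  set M₁ := κ * (Q + κ * ‖g‖) + 1 with hM₁
  have hM₁0 : 0 < M₁ := by positivity
  have hξb' : ∀ p : X × Y, ‖RKHS.kerFun G p.1 (ψ p.2 - g p.1)‖ ≤ M₁ := fun p =>
    (hξb p).trans (by rw [hM₁]; linarith)
  have : IsProbabilityMeasure (ρ.map Prod.fst) :=
    Measure.isProbabilityMeasure_map measurable_fst.aemeasurable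
  set μ := ρ.map Prod.fst with hμ
  set Φ := tensorSquare φ
  have hΦm : StronglyMeasurable Φ := (continuous_tensorSquare hφc).stronglyMeasurable
  have hΦb : ∀ x, ‖Φ x‖ ≤ κ ^ 2 := fun x => by
    rw [norm_tensorSquare, ← real_inner_self_eq_norm_sq, hφ]; exact hkb x
  set m₀ := ∫ x, Φ x ∂μ with hm₀
  have hm₀b : ‖m₀‖ ≤ κ ^ 2 := by
    simpa using norm_integral_le_of_norm_le_const (μ := μ) (ae_of_all _ hΦb)
  have hΦ1m : StronglyMeasurable fun p : X × Y => Φ p.1 := hΦm.comp_measurable measurable_fst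
  have hζm : StronglyMeasurable fun p : X × Y => m₀ - Φ p.1 := stronglyMeasurable_const.sub hΦ1m
  set M₂ := 2 * κ ^ 2 + 1 with hM₂
  have hM₂0 : 0 < M₂ := by positivity
  have hζb : ∀ p : X × Y, ‖m₀ - Φ p.1‖ ≤ M₂ := fun p =>
    (norm_sub_le _ _).trans (by rw [hM₂]; linarith [hΦb p.1])
  have hζ0 : ∫ p, (m₀ - Φ p.1) ∂ρ = 0 := by
    rw [integral_sub (integrable_const _) (Integrable.of_bound hΦ1m.aestronglyMeasurable _
      (ae_of_all _ fun p => hΦb p.1)), hm₀, hμ,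
      integral_map measurable_fst.aemeasurable hΦm.aestronglyMeasurable]
    simp
  -- `2 * Q * ‖V‖` comes from the comparison inequality, `2 * M₁` from the noise, `‖g‖` from the
  -- regularization bias and `2 * M₂` from the uniform deviation.
  refine ⟨2 * Q * ‖V‖ * ((2 * M₁ + ‖g‖) * (1 + 2 * M₂)), fun n hn τ hτ => ?_⟩
  obtain ⟨A, hA, hPA, hAz⟩ := exists_measurableSet_norm_sum_sq_le (μ := ρ) hξm hM₁0 hξb' hξ0
    hζm hM₂0 hζb hζ0 hn τ
  refine ⟨A, hA, hPA, fun z hz f hf f' hf' => ?_⟩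
  obtain ⟨hz1, hz2⟩ := hAz z hz
  have hn0 : (0 : ℝ) < n := by exact_mod_cast hn
  set lam := (n : ℝ) ^ (-(1 / 2) : ℝ) with hlam
  have hlam0 : 0 < lam := Real.rpow_pos_of_pos hn0 _
  have hlam2 : lam ^ 2 = (n : ℝ)⁻¹ := by
    rw [hlam, ← Real.rpow_natCast, ← Real.rpow_mul hn0.le, ← Real.rpow_neg_one]
    norm_num
  have hlam4 : √lam = (n : ℝ) ^ (-(1 / 4) : ℝ) := by
    rw [hlam, Real.sqrt_eq_rpow, ← Real.rpow_mul hn0.le]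
    norm_num
  have he := norm_inv_smul_le_of_sq_le hn hlam0 hlam2 hM₁0 hτ hz1
  have hD := norm_inv_smul_le_of_sq_le hn hlam0 hlam2 hM₂0 hτ hz2
  obtain ⟨δ, hδ, hen⟩ := exists_ridge_error (G := G) hG hk hn hlam0 (fun i => (z i).1)
    (fun i => ψ (z i).2) g
  have hδc : Continuous δ := continuous_coe_of_kernel_eq hG hkc δ
  have hdev := integral_norm_sq_sub_le (G := G) hG hkc hκ hkb hφ hφc μ (fun i => (z i).1) δ
  have hDeq : (n : ℝ)⁻¹ • ∑ i, (m₀ - Φ (z i).1) =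
      ∫ t, tensorSquare φ t ∂μ - (n : ℝ)⁻¹ • ∑ i, tensorSquare φ (z i).1 := by
    rw [Finset.sum_sub_distrib, smul_sub, Finset.sum_const, Finset.card_univ, Fintype.card_fin,
      ← Nat.cast_smul_eq_nsmul ℝ, smul_smul, inv_mul_cancel₀ hn0.ne', one_smul]
  rw [← hDeq] at hdev
  have hcomp := risk_sub_le_sqrt_integral_norm_sq (ρ := ρ) hψ hQ V hΔ hg hgC
    hδc.stronglyMeasurable (norm_apply_le_of_kernel_eq hG hκ hkb δ) hf.1 hf' (fun x y => by
      have h := hf.2 x y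
      have hrw : ∀ y, ∑ i, weights k lam (fun j => (z j).1) x i * Δ y (z i).2 =
          inner ℝ (ψ y) (V (g x + δ x)) := fun y => by
        rw [← hδ, map_sum, inner_sum]
        exact Finset.sum_congr rfl fun i _ => by rw [hΔ, map_smul, real_inner_smul_right]
      rwa [hrw, hrw] at h)
  have hIeq : ∫ p, ‖δ p.1‖ ^ 2 ∂ρ = ∫ t, ‖δ t‖ ^ 2 ∂μ := by
    rw [hμ, integral_map measurable_fst.aemeasurable]
    have : Continuous fun t => ‖δ t‖ ^ 2 := by fun_prop
    exact this.stronglyMeasurable.aestronglyMeasurable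
  have hsq := sqrt_le_of_energy_bound (C := 2 * M₁ + ‖g‖) (M := 2 * M₂) (s := 2 * M₁) (a := ‖g‖)
    hlam0 hτ (norm_nonneg δ) (by positivity) (by positivity) (by positivity)
    (hen.le.trans (by
      have h1 := real_inner_le_norm δ ((n : ℝ)⁻¹ • ∑ i, RKHS.kerFun G (z i).1
        (ψ (z i).2 - g (z i).1))
      have h2 := mul_le_mul_of_nonneg_left (neg_le_of_abs_le (abs_real_inner_le_norm δ g)) hlam0.le
      linarith)) (norm_nonneg g) he rfl hdev hD
  rw [← hlam4]
  calc _ ≤ _ := hcomp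
    _ ≤ 2 * Q * ‖V‖ * ((2 * M₁ + ‖g‖) * (1 + 2 * M₂) * τ ^ 2 * √lam) := by
        rw [hIeq]; gcongr
    _ = _ := by ring

end StructuredPrediction

theorem theorem3
    {X : Type*} [TopologicalSpace X] [PolishSpace X] [MeasurableSpace X] [BorelSpace X]
    {Y : Type*} [TopologicalSpace Y] [PolishSpace Y] [CompactSpace Y]
    [MeasurableSpace Y] [BorelSpace Y]
    {H : Type*} [NormedAddCommGroup H] [InnerProductSpace ℝ H] [CompleteSpace H]
    [TopologicalSpace.SeparableSpace H]
    (ρ : Measure (X × Y)) [IsProbabilityMeasure ρ]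
    (Δ : Y → Y → ℝ) (ψ : Y → H) (hψ : Continuous ψ) (V : H →L[ℝ] H)
    (hΔ : ∀ y y' : Y, Δ y y' = inner ℝ (ψ y) (V (ψ y')))
    (k : X → X → ℝ) (hk : IsReproducingKernel k)
    (hk_cont : Continuous fun p : X × X => k p.1 p.2)
    (hk_bdd : ∃ B : ℝ, ∀ x x' : X, |k x x'| ≤ B)
    (gstar : X → H) (hgstar : IsSurrogateMinimizer ρ ψ gstar) (hgstar_mem : MemRKHS k hk gstar) :
    ∃ c : ℝ, ∀ n : ℕ, 1 ≤ n → ∀ τ : ℝ, 0 < τ →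
      ∃ A : Set (Fin n → X × Y), MeasurableSet A ∧
        1 - 8 * Real.exp (-τ) ≤ (Measure.pi fun _ : Fin n => ρ).real A ∧
        ∀ z ∈ A, ∀ fhat : X → Y,
          IsAlgorithmOutput Δ k ((n : ℝ) ^ (-(1 / 2) : ℝ)) z fhat →
            risk ρ Δ fhat - optimalRisk ρ Δ ≤ c * τ ^ 2 * (n : ℝ) ^ (-(1 / 4) : ℝ) := by
  have : Fact (separableKernel H k).PosSemidef := ⟨separableKernel_posSemidef hk⟩
  have : Fact (separableKernel ℝ k).PosSemidef := ⟨separableKernel_posSemidef hk⟩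
  obtain ⟨B, hB⟩ := hk_bdd
  obtain ⟨Q, hQ⟩ := (isCompact_range hψ).isBounded.exists_norm_le
  obtain ⟨g, rfl⟩ := hgstar_mem
  have hF := RKHS.OfKernel.kernel_ofKernel (K := separableKernel ℝ k)
  obtain ⟨c, hc⟩ := exists_learning_rate (G := RKHS.OfKernel (separableKernel H k))
    RKHS.OfKernel.kernel_ofKernel hk hk_cont (κ := |B| + 1) (by positivity)
    (fun x => by
      have h1 := (le_abs_self _).trans ((hB x x).trans (le_abs_self B))
      nlinarith [abs_nonneg B])
    -- The canonical feature map of `k`: the scalar case `H = ℝ` of the same construction.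
    (φ := fun x => RKHS.kerFun (RKHS.OfKernel (separableKernel ℝ k)) x 1)
    (fun x x' => by rw [inner_kerFun_kerFun hF]; simp)
    ρ hψ.stronglyMeasurable (fun y => hQ _ ⟨y, rfl⟩) V hΔ g hgstar
  refine ⟨c, fun n hn τ hτ => ?_⟩
  rcases lt_or_ge τ 2 with h2 | h2
  -- For `τ < 2` the claim is vacuous, since `exp 2 < 8` makes the required probability nonpositive.
  · refine ⟨∅, MeasurableSet.empty, ?_, fun z hz => hz.elim⟩
    have h1 : Real.exp τ ≤ 8 := by
      have h3 : Real.exp τ ≤ Real.exp 1 * Real.exp 1 := by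
        rw [← Real.exp_add, Real.exp_le_exp]; linarith
      nlinarith [Real.exp_one_lt_d9, Real.exp_pos 1]
    have h4 : Real.exp τ * Real.exp (-τ) = 1 := by rw [← Real.exp_add]; simp
    have h5 := mul_le_mul_of_nonneg_right h1 (Real.exp_pos (-τ)).le
    rw [measureReal_empty]
    linarith
  · obtain ⟨A, hA, hPA, hAz⟩ := hc n hn τ h2
    refine ⟨A, hA, by linarith [Real.exp_pos (-τ)], fun z hz f hf => ?_⟩
    -- The bound holds against every measurable competitor, hence against the infimum, whether or
    -- not it is attained.
    have : Nonempty {f : X → Y // Measurable f} := ⟨⟨f, hf.1⟩⟩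
    rw [sub_le_comm]
    exact le_ciInf fun f' => by linarith [hAz z hz f hf f'.1 f'.2]
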